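/- Let $A\in\mathbb{R}^{n\times n}$, $B\in\mathbb{R}^{n\times m}$, $H\in\mathbb{R}^{n\times d}$, let $Q\succ0$, $R\succ0$, $Q^c\succeq0$ be symmetric matrices of sizes $n$, $m$, $n$, and let $\bar\beta\in\mathbb{R}$. Assume that $(A,B)$ is stabilizable and that $H$ has full row rank. Let $\mathbb{P}_W$ be a zero-mean probability measure on $\mathbb{R}^d$ that is non-singular with respect to Lebesgue measure (its absolutely continuous part is non-zero), with finite fourth moment and covariance $\Sigma_W\succ0$, and let $W\sim\mathbb{P}_W$. For $K\in\mathbb{R}^{m\times n}$ put $A_K=A+BK$ and $Q_K=Q+K^\intercal RK$, and let $\mathcal{S}$ be the set of all $K$ for which $A_K$ has spectral radius less than $1$. For $K\in\mathcal{S}$ let $\Sigma_K$ be the solution of $\Sigma_K=A_K\Sigma_KA_K^\intercal+H\Sigma_WH^\intercal$. Put $$m_4=\mathbb{E}\big[\operatorname{tr}\big(Q^cH(WW^\intercal-\Sigma_W)H^\intercal\big)^2\big],\qquad \beta=-4\operatorname{tr}\big((Q^cH\Sigma_WH^\intercal)^2\big)+m_4-\bar\beta,$$ $$\gamma_N^2(K)=4\operatorname{tr}\big(Q^cH\Sigma_WH^\intercal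 Q^c(\Sigma_K-H\Sigma_WH^\intercal)\big)+m_4,$$ and, for a fixed $\lambda\ge0$, $L_\lambda(K)=\operatorname{tr}(Q_K\Sigma_K)+\lambda(\gamma_N^2(K)-\bar\beta)$ for $K\in\mathcal{S}$. Here $\operatorname{tr}(\cdot)^2$ is the square of the trace, the gradient $\nabla$ is taken with respect to the Frobenius inner product, and $\|\cdot\|_F$ is the Frobenius norm. Then $\mathcal{S}$ is open, and for every $K\in\mathcal{S}$ the matrix $\Sigma_K$ exists, is unique and is positive definite. Moreover: (i) $L_\lambda$ and $\gamma_N^2$ are $C^\infty$ on $\mathcal{S}$, and for every $K\in\mathcal{S}$ $$\nabla L_\lambda(K)=2\big(RK+B^\intercal P_{(K,\lambda)}A_K\big)\Sigma_K,$$ where $P_{(K,\lambda)}$ is the unique solution of $P=A_K^\intercal PA_K+Q_K+4\lambda Q^cH\Sigma_WH^\intercal Q^c$. (ii) $L_\lambda$ is coercive on $\mathcal{S}$: it tends to $+\infty$ when $K\in\mathcal{S}$ tends to infinity in norm or to a boundary point of $\mathcal{S}$. For every $\alpha\in\mathbb{R}$ the sublevel set $\mathcal{S}_\alpha=\{K\in\mathcal{S}: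 L_\lambda(K)\le\alpha\}$ is compact. (iii) $L_\lambda$ has a unique global minimizer $K^*=K^*(\lambda)$ over $\mathcal{S}$. With $P^*=P_{(K^*,\lambda)}$, the matrix $R+B^\intercal P^*B$ is invertible, $$K^*=-(R+B^\intercal P^*B)^{-1}B^\intercal P^*A,\qquad L_\lambda(K^*)=\operatorname{tr}(P^*H\Sigma_WH^\intercal)+\lambda\beta.$$ (iv) For every $\alpha\in\mathbb{R}$ with $\mathcal{S}_\alpha\ne\emptyset$ there are constants $\ell,c_1,c_2>0$ such that for all $K,K'\in\mathcal{S}_\alpha$ $$\|\nabla L_\lambda(K)-\nabla L_\lambda(K')\|_F\le\ell\|K-K'\|_F,$$ $$c_2\|K-K^*\|_F^2\le c_1\big[L_\lambda(K)-L_\lambda(K^*)\big]\le\|\nabla L_\lambda(K)\|_F^2,$$ that is, on $\mathcal{S}_\alpha$ the function $L_\lambda$ has Lipschitz continuous gradient, has a quadratic lower model and is gradient dominated. -/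

import Mathlib

open Filter Topology MeasureTheory
open scoped Matrix ContDiff

/- Spaces of real matrices carry the Frobenius norm. -/
attribute [local instance] Matrix.frobeniusNormedAddCommGroup Matrix.frobeniusNormedSpace

noncomputable section

namespace RiskLQR

/-- A square real matrix is Schur stable if its (complex) spectral radius is less than one. -/
def IsSchur {n : ℕ} (M : Matrix (Fin n) (Fin n) ℝ) : Prop :=
  spectralRadius ℂ (M.map (algebraMap ℝ ℂ)) < 1

/-- The pair `(A, B)` is stabilizable: some linear feedback makes the closed loop Schur stable. -/
def IsStabilizable {n m : ℕ} (A : Matrix (Fin n) (Fin n) ℝ) (B : Matrix (Fin n) (Fin m) ℝ) :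
    Prop :=
  ∃ K : Matrix (Fin m) (Fin n) ℝ, IsSchur (A + B * K)

open Classical in
/-- The unique solution `X` of the discrete Lyapunov equation `X = F X Fᵀ + N`
(and `0` if there is no solution or more than one). -/
def dlyap {n : ℕ} (F N : Matrix (Fin n) (Fin n) ℝ) : Matrix (Fin n) (Fin n) ℝ :=
  if h : ∃! X : Matrix (Fin n) (Fin n) ℝ, X = F * X * Fᵀ + N then h.choose else 0

/-- The covariance matrix of a law on `ℝᵈ`. -/
def covMat {d : ℕ} (μ : Measure (EuclideanSpace ℝ (Fin d))) : Matrix (Fin d) (Fin d) ℝ :=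
  Matrix.of fun i j => ProbabilityTheory.covariance (fun w => w i) (fun w => w j) μ

/-- The standing assumptions on the common law of the i.i.d. process noise: a zero-mean
probability measure that is non-singular with respect to Lebesgue measure (its absolutely
continuous part is not zero), with finite fourth moment and positive definite covariance. -/
structure IsNoiseLaw {d : ℕ} (μ : Measure (EuclideanSpace ℝ (Fin d))) : Prop where
  isProbabilityMeasure : IsProbabilityMeasure μ
  mean_zero : ∫ w, w ∂μ = 0
  nonsingular : ¬ μ ⟂ₘ (volume : Measure (EuclideanSpace ℝ (Fin d)))
  fourth_moment : MemLp (fun w => w) 4 μ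
  cov_posDef : (covMat μ).PosDef

/-- The gradient of `f` at `K` for the Frobenius inner product `⟨G, E⟩ = tr (Gᵀ E)`: the matrix of
partial derivatives (meaningful where `f` is differentiable). -/
def frobGrad {m n : ℕ} (f : Matrix (Fin m) (Fin n) ℝ → ℝ) (K : Matrix (Fin m) (Fin n) ℝ) :
    Matrix (Fin m) (Fin n) ℝ :=
  Matrix.of fun i j => fderiv ℝ f K (Matrix.single i j 1)

theorem trace_frobGrad_mul {m n : ℕ} (f : Matrix (Fin m) (Fin n) ℝ → ℝ)
    (K E : Matrix (Fin m) (Fin n) ℝ) :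
    ((frobGrad f K)ᵀ * E).trace = fderiv ℝ f K E := by
  conv_rhs => rw [Matrix.matrix_eq_sum_single E]
  simp only [map_sum, Matrix.trace, Matrix.diag, Matrix.mul_apply, Matrix.transpose_apply,
    frobGrad, Matrix.of_apply]
  rw [Finset.sum_comm]
  refine Finset.sum_congr rfl fun i _ => Finset.sum_congr rfl fun j _ => ?_
  have h : Matrix.single i j (E i j) = E i j • Matrix.single i j (1 : ℝ) := by
    simp [Matrix.smul_single]
  rw [h, map_smul, smul_eq_mul, mul_comm]

/-- `f` is coercive on `S`: it tends to `+∞` whenever its argument, staying in `S`, goes to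
infinity in norm or approaches a boundary point of `S`. -/
def CoerciveOn {E : Type*} [NormedAddCommGroup E] (f : E → ℝ) (S : Set E) : Prop :=
  Tendsto f (Bornology.cobounded E ⊓ 𝓟 S) atTop ∧
    ∀ x ∈ frontier S, Tendsto f (𝓝[S] x) atTop

/-- The data of a risk-constrained linear quadratic problem: dynamics
`X (t+1) = A X t + B U t + H W (t+1)`, cost `xᵀ Q x + uᵀ R u`, risk functional `xᵀ Qc x`, the
law of the noise `W t`, and the risk level `betaBar`. -/
structure Data (n m d : ℕ) where
  A : Matrix (Fin n) (Fin n) ℝ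
  B : Matrix (Fin n) (Fin m) ℝ
  H : Matrix (Fin n) (Fin d) ℝ
  Q : Matrix (Fin n) (Fin n) ℝ
  R : Matrix (Fin m) (Fin m) ℝ
  Qc : Matrix (Fin n) (Fin n) ℝ
  law : Measure (EuclideanSpace ℝ (Fin d))
  betaBar : ℝ

namespace Data

variable {n m d : ℕ} (p : Data n m d)

/-- The closed-loop matrix `A_K = A + B K`. -/
def AK (K : Matrix (Fin m) (Fin n) ℝ) : Matrix (Fin n) (Fin n) ℝ := p.A + p.B * K

/-- The set of stabilizing policies. -/
def stab : Set (Matrix (Fin m) (Fin n) ℝ) := {K | IsSchur (p.AK K)}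

/-- `Q_K = Q + Kᵀ R K`. -/
def QK (K : Matrix (Fin m) (Fin n) ℝ) : Matrix (Fin n) (Fin n) ℝ := p.Q + Kᵀ * p.R * K

/-- The state noise covariance `H Σ_W Hᵀ`. -/
def noiseCov : Matrix (Fin n) (Fin n) ℝ := p.H * covMat p.law * p.Hᵀ

/-- The stationary state covariance: `Σ_K = A_K Σ_K A_Kᵀ + H Σ_W Hᵀ`. -/
def Sig (K : Matrix (Fin m) (Fin n) ℝ) : Matrix (Fin n) (Fin n) ℝ := dlyap (p.AK K) p.noiseCov

/-- `m₄[Qc] = E[(tr (Qc H (W Wᵀ - Σ_W) Hᵀ))²]`. -/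
def m4 : ℝ :=
  ∫ w, (p.Qc * p.H * (Matrix.vecMulVec w.ofLp w.ofLp - covMat p.law) * p.Hᵀ).trace ^ 2 ∂p.law

/-- The asymptotic conditional variance
`γ_N²(K) = 4 tr (Qc H Σ_W Hᵀ Qc (Σ_K - H Σ_W Hᵀ)) + m₄[Qc]`. -/
def gammaSq (K : Matrix (Fin m) (Fin n) ℝ) : ℝ :=
  4 * (p.Qc * p.noiseCov * p.Qc * (p.Sig K - p.noiseCov)).trace + p.m4

/-- The Lagrangian `L_λ(K) = tr (Q_K Σ_K) + λ (γ_N²(K) - betaBar)`. -/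
def lagr (lam : ℝ) (K : Matrix (Fin m) (Fin n) ℝ) : ℝ :=
  (p.QK K * p.Sig K).trace + lam * (p.gammaSq K - p.betaBar)

/-- `β[Qc] = -4 tr ((Qc H Σ_W Hᵀ)²) + m₄[Qc] - betaBar`. -/
def betaConst : ℝ := -4 * ((p.Qc * p.noiseCov) ^ 2).trace + p.m4 - p.betaBar

/-- The constant term `Q_K + 4 λ Qc H Σ_W Hᵀ Qc` of the Lyapunov equation for `P_(K,λ)`. -/
def costK (lam : ℝ) (K : Matrix (Fin m) (Fin n) ℝ) : Matrix (Fin n) (Fin n) ℝ :=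
  p.QK K + (4 * lam) • (p.Qc * p.noiseCov * p.Qc)

/-- `P_(K,λ) = A_Kᵀ P_(K,λ) A_K + Q_K + 4 λ Qc H Σ_W Hᵀ Qc`. -/
def P (lam : ℝ) (K : Matrix (Fin m) (Fin n) ℝ) : Matrix (Fin n) (Fin n) ℝ :=
  dlyap (p.AK K)ᵀ (p.costK lam K)

/-- The sublevel set `S_α` of the Lagrangian in the set of stabilizing policies. -/
def sublevel (lam α : ℝ) : Set (Matrix (Fin m) (Fin n) ℝ) :=
  {K | K ∈ p.stab ∧ p.lagr lam K ≤ α}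

end Data

end RiskLQR

end

noncomputable section

namespace RiskLQR

/-! ### Positive semidefinite matrices and trace inequalities -/

section PosSemidef

/-! Write W for `noiseCov`. The risk term is affine in Σ_K, so up to a constant the Lagrangian is an
ordinary LQR cost tr((C + KᵀRK) Σ_K) with state cost C = Q + 4λ Qc W Qc, still positive definite
(`lagr_eq`). Duality of the two Lyapunov equations (`trace_mul_dlyap`) turns this into tr(P_K W).

The core is an exact identity, `lagr_sub_lagr`. With M = RK + BᵀP_K A_K and D = K' - K, L(K') - L(K)
= 2 tr(Mᵀ D Σ_{K'}) + tr(Dᵀ (R + BᵀP_K B) D Σ_{K'}). Letting K' tend to K along a line gives the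
gradient 2 M Σ_K. Since R + BᵀP_K B ≥ R ≥ r > 0 and Σ_{K'} ≥ W ≥ w > 0, the quadratic term is at
least r w ‖D‖². At a minimizer M = 0, which yields quadratic growth and uniqueness; at a general K,
completing the square yields gradient dominance.

Compactness of sublevel sets comes from viewing them as projections of closed bounded sets of pairs
(K, X), where Lyapunov's criterion recovers stability from X. Compactness gives existence of the
minimizer, coercivity and, with smoothness, the Lipschitz gradient. -/

theorem transpose_eq_of_posSemidef {ι : Type*} {X : Matrix ι ι ℝ} (hX : X.PosSemidef) :
    Xᵀ = X := by
  simpa using hX.isHermitian.eq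

variable {ι κ : Type*} [Fintype ι] [Fintype κ]

theorem dotProduct_self_mulVec_nonneg {X : Matrix ι ι ℝ} (hX : X.PosSemidef) (v : ι → ℝ) :
    0 ≤ v ⬝ᵥ (X *ᵥ v) := by
  simpa using hX.dotProduct_mulVec_nonneg v

theorem posSemidef_mul_mul_transpose {X : Matrix ι ι ℝ} (hX : X.PosSemidef) (F : Matrix κ ι ℝ) :
    (F * X * Fᵀ).PosSemidef := by
  simpa using hX.mul_mul_conjTranspose_same F

theorem posSemidef_transpose_mul_mul {X : Matrix ι ι ℝ} (hX : X.PosSemidef) (F : Matrix ι κ ℝ) :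
    (Fᵀ * X * F).PosSemidef := by
  simpa using hX.conjTranspose_mul_mul_same F

theorem posSemidef_transpose_mul_self (F : Matrix ι κ ℝ) : (Fᵀ * F).PosSemidef := by
  simpa using Matrix.posSemidef_conjTranspose_mul_self F

/-- The cone of positive semidefinite matrices is closed. -/
theorem isClosed_posSemidef : IsClosed {X : Matrix ι ι ℝ | X.PosSemidef} := by
  have : {X : Matrix ι ι ℝ | X.PosSemidef} =
      {X | Xᵀ = X} ∩ ⋂ v : ι → ℝ, {X | 0 ≤ v ⬝ᵥ (X *ᵥ v)} := by
    ext X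
    simp [Matrix.posSemidef_iff_dotProduct_mulVec, Matrix.IsHermitian]
  rw [this]
  refine (isClosed_eq (by fun_prop) continuous_id).inter (isClosed_iInter fun v => ?_)
  exact isClosed_le continuous_const (by fun_prop)

variable [DecidableEq ι]

open scoped MatrixOrder in
theorem exists_eq_transpose_mul_self {X : Matrix ι ι ℝ} (hX : X.PosSemidef) :
    ∃ C : Matrix ι ι ℝ, X = Cᵀ * C := by
  obtain ⟨C, hC⟩ := CStarAlgebra.nonneg_iff_eq_star_mul_self.mp hX.nonneg
  exact ⟨C, by simpa [Matrix.star_eq_conjTranspose] using hC⟩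

/-- With X = CᵀC, cyclicity gives tr(XY) = tr(C Y Cᵀ). -/
theorem trace_mul_nonneg {X Y : Matrix ι ι ℝ} (hX : X.PosSemidef) (hY : Y.PosSemidef) :
    0 ≤ (X * Y).trace := by
  obtain ⟨C, rfl⟩ := exists_eq_transpose_mul_self hX
  rw [Matrix.mul_assoc, Matrix.trace_mul_comm]
  exact (posSemidef_mul_mul_transpose hY C).trace_nonneg

/-- A positive definite matrix dominates a positive multiple of the identity. -/
theorem exists_posSemidef_sub_smul_one {Y : Matrix ι ι ℝ} (hY : Y.PosDef) :
    ∃ ε : ℝ, 0 < ε ∧ (Y - ε • (1 : Matrix ι ι ℝ)).PosSemidef := by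
  obtain ⟨ε, hε, hle⟩ : ∃ ε : ℝ, 0 < ε ∧ ∀ i, ε ≤ hY.isHermitian.eigenvalues i := by
    cases isEmpty_or_nonempty ι
    · exact ⟨1, one_pos, fun i => isEmptyElim i⟩
    · obtain ⟨i, hi⟩ := Finite.exists_min hY.isHermitian.eigenvalues
      exact ⟨_, hY.eigenvalues_pos i, hi⟩
  refine ⟨ε, hε, ?_⟩
  have hsp := hY.isHermitian.spectral_theorem
  set U := hY.isHermitian.eigenvectorUnitary
  have hdiag : (Matrix.diagonal fun i => hY.isHermitian.eigenvalues i - ε).PosSemidef :=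
    Matrix.PosSemidef.diagonal fun i => sub_nonneg.2 (hle i)
  have key : Y - ε • (1 : Matrix ι ι ℝ) = (U : Matrix ι ι ℝ) *
      (Matrix.diagonal fun i => hY.isHermitian.eigenvalues i - ε) * (U : Matrix ι ι ℝ)ᴴ := by
    have hU : (U : Matrix ι ι ℝ) * (U : Matrix ι ι ℝ)ᴴ = 1 := Unitary.coe_mul_star_self U
    have hd : (Matrix.diagonal fun i => hY.isHermitian.eigenvalues i - ε) =
        Matrix.diagonal hY.isHermitian.eigenvalues - ε • (1 : Matrix ι ι ℝ) := by
      rw [Matrix.smul_one_eq_diagonal, Matrix.diagonal_sub]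
    rw [hd, Matrix.mul_sub, Matrix.sub_mul, Matrix.mul_smul, Matrix.smul_mul, Matrix.mul_one, hU]
    exact congrArg (· - ε • (1 : Matrix ι ι ℝ)) hsp
  rw [key]
  exact hdiag.mul_mul_conjTranspose_same _

/-- If `Y ≥ ε` then `tr (X Y) ≥ ε tr X` for positive semidefinite `X`. -/
theorem mul_trace_le_trace_mul {X Y : Matrix ι ι ℝ} {ε : ℝ} (hX : X.PosSemidef)
    (hY : (Y - ε • (1 : Matrix ι ι ℝ)).PosSemidef) : ε * X.trace ≤ (X * Y).trace := by
  have := trace_mul_nonneg hX hY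
  rw [Matrix.mul_sub, Matrix.mul_smul, Matrix.mul_one, Matrix.trace_sub, Matrix.trace_smul,
    smul_eq_mul] at this
  linarith

end PosSemidef

/-! ### Frobenius norm estimates -/

section Frobenius

variable {ι κ : Type*} [Fintype ι] [Fintype κ]

theorem trace_transpose_mul_self (M : Matrix ι κ ℝ) : (Mᵀ * M).trace = ‖M‖ ^ 2 := by
  rw [Matrix.frobenius_norm_def, ← Real.sqrt_eq_rpow, Real.sq_sqrt (by positivity)]
  simp only [Matrix.trace, Matrix.diag, Matrix.mul_apply, Matrix.transpose_apply]
  rw [Finset.sum_comm]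
  simp [pow_two]

theorem norm_le_trace [DecidableEq ι] {X : Matrix ι ι ℝ} (hX : X.PosSemidef) : ‖X‖ ≤ X.trace := by
  obtain ⟨C, rfl⟩ := exists_eq_transpose_mul_self hX
  rw [trace_transpose_mul_self, pow_two]
  simpa using Matrix.frobenius_norm_mul Cᵀ C

/-- For `R ≥ r` and `Y ≥ w` one has `tr (Dᵀ R D Y) ≥ r w ‖D‖²`. -/
theorem mul_norm_sq_le_trace [DecidableEq ι] [DecidableEq κ] {R : Matrix ι ι ℝ} {Y : Matrix κ κ ℝ}
    {r w : ℝ} (hr : (R - r • (1 : Matrix ι ι ℝ)).PosSemidef) (hr0 : R.PosSemidef) (hw0 : 0 ≤ w)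
    (hw : (Y - w • (1 : Matrix κ κ ℝ)).PosSemidef) (D : Matrix ι κ ℝ) :
    r * w * ‖D‖ ^ 2 ≤ (Dᵀ * R * D * Y).trace := by
  have h1 := mul_trace_le_trace_mul (posSemidef_transpose_mul_mul hr0 D) hw
  have h2 : r * ‖D‖ ^ 2 ≤ (Dᵀ * R * D).trace := by
    have := mul_trace_le_trace_mul (posSemidef_transpose_mul_self Dᵀ) hr
    rw [trace_transpose_mul_self, Matrix.frobenius_norm_transpose, Matrix.transpose_transpose,
      Matrix.mul_assoc, Matrix.trace_mul_comm] at this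
    exact this
  calc r * w * ‖D‖ ^ 2 = w * (r * ‖D‖ ^ 2) := by ring
    _ ≤ w * (Dᵀ * R * D).trace := by gcongr
    _ ≤ _ := h1

end Frobenius

/-! ### Schur stability: powers, openness, Lyapunov's criterion -/

section Schur

variable {n : ℕ}

section ComplexNorm

attribute [local instance] Matrix.frobeniusNormedRing Matrix.frobeniusNormedAlgebra

theorem norm_map_pow (F : Matrix (Fin n) (Fin n) ℝ) (k : ℕ) :
    ‖(F.map (algebraMap ℝ ℂ)) ^ k‖ = ‖F ^ k‖ := by
  rw [← Matrix.map_pow]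
  exact Matrix.frobenius_norm_map_eq _ _ fun a => by simp

/-- From ρ(F)^k ≤ ρ(F^k). The factor ‖1‖ appears because the Frobenius norm of the identity is not 1
in general. -/
theorem isSchur_of_norm_pow_lt_one {F : Matrix (Fin n) (Fin n) ℝ} {k : ℕ} (hk : k ≠ 0)
    (h : ‖F ^ k‖ * ‖(1 : Matrix (Fin n) (Fin n) ℂ)‖ < 1) : IsSchur F := by
  rw [IsSchur]
  by_contra! hge
  have h1 := spectrum.spectralRadius_pow_le (𝕜 := ℂ) (F.map (algebraMap ℝ ℂ)) k hk
  have h2 : spectralRadius ℂ ((F.map (algebraMap ℝ ℂ)) ^ k) < 1 := by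
    cases isEmpty_or_nonempty (Fin n)
    · simp [spectralRadius, spectrum.of_subsingleton]
    refine spectrum.spectralRadius_lt_of_forall_lt (r := 1) _ fun z hz => ?_
    have := spectrum.norm_le_norm_mul_of_mem hz
    rw [norm_map_pow] at this
    exact_mod_cast this.trans_lt h
  exact absurd (h1.trans_lt h2) (not_lt.2 (one_le_pow_of_one_le' hge k))

/-- Gelfand's formula: for q strictly between the spectral radius and 1, eventually ‖F^k‖ ≤ q^k. -/
theorem tendsto_pow_of_isSchur {F : Matrix (Fin n) (Fin n) ℝ} (h : IsSchur F) :
    Tendsto (fun k : ℕ => F ^ k) atTop (𝓝 0) := by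
  rw [IsSchur] at h
  obtain ⟨q, hq1, hq2⟩ := ENNReal.lt_iff_exists_nnreal_btwn.mp h
  have hev := (spectrum.pow_nnnorm_pow_one_div_tendsto_nhds_spectralRadius
    (F.map (algebraMap ℝ ℂ))).eventually_lt_const hq1
  have hq : (q : ℝ) < 1 := by exact_mod_cast hq2
  refine tendsto_zero_iff_norm_tendsto_zero.2 ?_
  refine squeeze_zero' (Eventually.of_forall fun _ => norm_nonneg _) ?_
    (tendsto_pow_atTop_nhds_zero_of_lt_one q.2 hq)
  filter_upwards [hev, eventually_gt_atTop 0] with k hk hk0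
  rw [← norm_map_pow]
  have hk' : (0 : ℝ) < k := by exact_mod_cast hk0
  rw [one_div, ENNReal.rpow_inv_lt_iff hk', ENNReal.rpow_natCast] at hk
  exact_mod_cast hk.le

end ComplexNorm

/-- Stability is certified by one power k with ‖F^k‖ small, a strict inequality that is continuous
in F. -/
theorem isOpen_isSchur : IsOpen {F : Matrix (Fin n) (Fin n) ℝ | IsSchur F} := by
  rw [isOpen_iff_mem_nhds]
  intro F hF
  set c := ‖(1 : Matrix (Fin n) (Fin n) ℂ)‖
  have h0 : Tendsto (fun k : ℕ => ‖F ^ k‖ * c) atTop (𝓝 0) := by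
    simpa using (tendsto_zero_iff_norm_tendsto_zero.1 (tendsto_pow_of_isSchur hF)).mul_const c
  have h1 := (h0.eventually_lt_const one_pos).and (eventually_ne_atTop 0)
  obtain ⟨k, hk, hk0⟩ := h1.exists
  have hpow : Continuous fun G : Matrix (Fin n) (Fin n) ℝ => G ^ k := continuous_pow k
  have hc : Continuous fun G : Matrix (Fin n) (Fin n) ℝ => ‖G ^ k‖ * c :=
    (continuous_norm.comp hpow).mul_const c
  filter_upwards [hc.continuousAt.eventually_lt_const hk] with G hG
  exact isSchur_of_norm_pow_lt_one hk0 hG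

theorem tendsto_transpose_pow {F : Matrix (Fin n) (Fin n) ℝ}
    (h : Tendsto (fun k : ℕ => F ^ k) atTop (𝓝 0)) :
    Tendsto (fun k : ℕ => Fᵀ ^ k) atTop (𝓝 0) := by
  have hc : Continuous fun G : Matrix (Fin n) (Fin n) ℝ => Gᵀ := by fun_prop
  have := (hc.tendsto 0).comp h
  simpa [Function.comp_def, Matrix.transpose_pow] using this

/-- **Lyapunov's criterion**: if `X ≥ 0` and `X - F X Fᵀ > 0`, then `F` is Schur stable. -/
theorem isSchur_of_posDef_sub {F X : Matrix (Fin n) (Fin n) ℝ} (hX : X.PosSemidef)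
    (hN : (X - F * X * Fᵀ).PosDef) : IsSchur F := by
  rw [IsSchur]
  cases isEmpty_or_nonempty (Fin n)
  · simp [spectralRadius, spectrum.of_subsingleton]
  let _ := Matrix.frobeniusNormedRing (m := Fin n) (α := ℂ)
  let _ := Matrix.frobeniusNormedAlgebra (m := Fin n) (R := ℂ) (α := ℂ)
  refine spectrum.spectralRadius_lt_of_forall_lt (r := 1) _ fun z hz => ?_
  rw [spectrum.mem_iff, Matrix.isUnit_iff_isUnit_det, isUnit_iff_ne_zero, not_not,
    ← Matrix.exists_vecMul_eq_zero_iff] at hz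
  obtain ⟨v, hv0, hv⟩ := hz
  rw [Matrix.vecMul_sub, sub_eq_zero, Algebra.algebraMap_eq_smul_one, Matrix.vecMul_smul,
    Matrix.vecMul_one] at hv
  -- Splitting the left eigenvector v into real and imaginary parts keeps all quadratic forms real.
  set a : Fin n → ℝ := fun i => (v i).re with ha
  set b : Fin n → ℝ := fun i => (v i).im with hb
  have hFa : a ᵥ* F = z.re • a - z.im • b := by
    ext i
    have := congrArg Complex.re (congrFun hv i)
    simp [Matrix.vecMul, dotProduct, ha, hb] at this ⊢
    exact this.symm
  have hFb : b ᵥ* F = z.re • b + z.im • a := by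
    ext i
    have := congrArg Complex.im (congrFun hv i)
    simp [Matrix.vecMul, dotProduct, ha, hb] at this ⊢
    exact this.symm
  have hq : ∀ x : Fin n → ℝ, x ⬝ᵥ ((X - F * X * Fᵀ) *ᵥ x) =
      x ⬝ᵥ (X *ᵥ x) - (x ᵥ* F) ⬝ᵥ (X *ᵥ (x ᵥ* F)) := by
    intro x
    rw [Matrix.sub_mulVec, dotProduct_sub, ← Matrix.mulVec_mulVec, ← Matrix.mulVec_mulVec,
      Matrix.mulVec_transpose, Matrix.dotProduct_mulVec x F]
  have hcomm : b ⬝ᵥ (X *ᵥ a) = a ⬝ᵥ (X *ᵥ b) := by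
    rw [Matrix.dotProduct_mulVec, ← Matrix.mulVec_transpose, transpose_eq_of_posSemidef hX,
      dotProduct_comm]
  -- The real form of v(X - FXFᵀ)v* = (1 - |z|²) vXv*; positivity of the left side forces |z| < 1.
  have hsum : a ⬝ᵥ ((X - F * X * Fᵀ) *ᵥ a) + b ⬝ᵥ ((X - F * X * Fᵀ) *ᵥ b) =
      (1 - ‖z‖ ^ 2) * (a ⬝ᵥ (X *ᵥ a) + b ⬝ᵥ (X *ᵥ b)) := by
    rw [hq, hq, hFa, hFb, ← Complex.normSq_eq_norm_sq, Complex.normSq_apply]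
    simp only [Matrix.mulVec_sub, Matrix.mulVec_add, Matrix.mulVec_smul, dotProduct_sub,
      dotProduct_add, sub_dotProduct, add_dotProduct, smul_dotProduct, dotProduct_smul,
      smul_eq_mul, hcomm]
    ring
  have hpos : 0 < a ⬝ᵥ ((X - F * X * Fᵀ) *ᵥ a) + b ⬝ᵥ ((X - F * X * Fᵀ) *ᵥ b) := by
    have hNn := dotProduct_self_mulVec_nonneg hN.posSemidef
    by_cases ha0 : a = 0
    · have hb0 : b ≠ 0 := by
        rintro hb0
        exact hv0 (funext fun i => Complex.ext (congrFun ha0 i) (congrFun hb0 i))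
      exact add_pos_of_nonneg_of_pos (hNn a) (by simpa using hN.dotProduct_mulVec_pos hb0)
    · exact add_pos_of_pos_of_nonneg (by simpa using hN.dotProduct_mulVec_pos ha0) (hNn b)
  rw [hsum] at hpos
  have h0 : 0 ≤ a ⬝ᵥ (X *ᵥ a) + b ⬝ᵥ (X *ᵥ b) :=
    add_nonneg (dotProduct_self_mulVec_nonneg hX a) (dotProduct_self_mulVec_nonneg hX b)
  have h1 : 0 < 1 - ‖z‖ ^ 2 := pos_of_mul_pos_left hpos h0
  have h2 : ‖z‖ < 1 := by nlinarith [norm_nonneg z]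
  exact_mod_cast h2

end Schur

/-! ### The discrete Lyapunov equation -/

section Lyapunov

variable {n : ℕ} {F N X : Matrix (Fin n) (Fin n) ℝ}

/-- The linear map `X ↦ X - F X Fᵀ`. -/
def lyapMap (F : Matrix (Fin n) (Fin n) ℝ) :
    Matrix (Fin n) (Fin n) ℝ →ₗ[ℝ] Matrix (Fin n) (Fin n) ℝ where
  toFun X := X - F * X * Fᵀ
  map_add' X Y := by simp only [Matrix.mul_add, Matrix.add_mul]; abel
  map_smul' c X := by simp [smul_sub]

theorem lyapMap_apply : lyapMap F X = X - F * X * Fᵀ := rfl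

theorem lyapMap_eq_iff : lyapMap F X = N ↔ X = F * X * Fᵀ + N := by
  rw [lyapMap_apply, sub_eq_iff_eq_add, add_comm]

/-- Iterating X = F X Fᵀ gives X = F^k X (Fᵀ)^k, which tends to 0. In finite dimension injectivity
also gives existence of solutions. -/
theorem lyapMap_injective (hF : Tendsto (fun k : ℕ => F ^ k) atTop (𝓝 0)) :
    Function.Injective (lyapMap F) := by
  rw [← LinearMap.ker_eq_bot, LinearMap.ker_eq_bot']
  intro X hX
  have hX : X = F * X * Fᵀ := by simpa using lyapMap_eq_iff.1 hX
  have hk : ∀ k : ℕ, F ^ k * X * Fᵀ ^ k = X := by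
    intro k
    induction k with
    | zero => simp
    | succ k ih =>
      calc F ^ (k + 1) * X * Fᵀ ^ (k + 1) = F ^ k * (F * X * Fᵀ) * Fᵀ ^ k := by
            rw [pow_succ, pow_succ']; simp only [Matrix.mul_assoc]
        _ = X := by rw [← hX, ih]
  have ht : Tendsto (fun k : ℕ => F ^ k * X * Fᵀ ^ k) atTop (𝓝 (0 * X * 0)) :=
    (hF.mul tendsto_const_nhds).mul (tendsto_transpose_pow hF)
  simp only [hk, Matrix.mul_zero] at ht
  exact tendsto_nhds_unique tendsto_const_nhds ht

theorem existsUnique_lyap (hF : Tendsto (fun k : ℕ => F ^ k) atTop (𝓝 0))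
    (N : Matrix (Fin n) (Fin n) ℝ) :
    ∃! X : Matrix (Fin n) (Fin n) ℝ, X = F * X * Fᵀ + N := by
  have hinj := lyapMap_injective hF
  obtain ⟨X, hX⟩ := LinearMap.injective_iff_surjective.1 hinj N
  exact ⟨X, lyapMap_eq_iff.1 hX, fun Y hY => hinj ((lyapMap_eq_iff.2 hY).trans hX.symm)⟩

theorem eq_lyap_iff_eq_dlyap (hF : Tendsto (fun k : ℕ => F ^ k) atTop (𝓝 0)) :
    X = F * X * Fᵀ + N ↔ X = dlyap F N := by
  have h := existsUnique_lyap hF N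
  have hd : dlyap F N = F * dlyap F N * Fᵀ + N := by
    rw [dlyap, dif_pos h]
    exact h.choose_spec.1
  exact ⟨fun hX => h.unique hX hd, fun hX => hX ▸ hd⟩

theorem dlyap_eq (hF : Tendsto (fun k : ℕ => F ^ k) atTop (𝓝 0)) :
    dlyap F N = F * dlyap F N * Fᵀ + N :=
  (eq_lyap_iff_eq_dlyap hF).2 rfl

/-- Xᵀ solves the same equation, so X is symmetric by uniqueness. Each X - F^k X (Fᵀ)^k is a partial
sum of Σ F^j N (Fᵀ)^j, hence semidefinite, and it converges to X in a closed cone. -/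
theorem posSemidef_dlyap (hF : Tendsto (fun k : ℕ => F ^ k) atTop (𝓝 0)) (hN : N.PosSemidef) :
    (dlyap F N).PosSemidef := by
  have heq := dlyap_eq (N := N) hF
  have hsymm : (dlyap F N)ᵀ = dlyap F N := by
    refine (eq_lyap_iff_eq_dlyap hF).1 ?_
    have := congrArg Matrix.transpose heq
    simpa [Matrix.transpose_mul, Matrix.mul_assoc, transpose_eq_of_posSemidef hN] using this
  set X := dlyap F N
  have hk : ∀ k : ℕ, (X - F ^ k * X * Fᵀ ^ k).PosSemidef := by
    intro k
    induction k with
    | zero => simpa using Matrix.PosSemidef.zero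
    | succ k ih =>
      have h1 := (posSemidef_mul_mul_transpose ih F).add hN
      have h2 : F * (X - F ^ k * X * Fᵀ ^ k) * Fᵀ + N = X - F ^ (k + 1) * X * Fᵀ ^ (k + 1) := by
        calc _ = (F * X * Fᵀ + N) - F ^ (k + 1) * X * Fᵀ ^ (k + 1) := by
              rw [pow_succ', pow_succ]
              simp only [Matrix.mul_sub, Matrix.sub_mul, Matrix.mul_assoc]
              abel
          _ = _ := by rw [← heq]
      rwa [h2] at h1
  have ht : Tendsto (fun k : ℕ => X - F ^ k * X * Fᵀ ^ k) atTop (𝓝 (X - 0 * X * 0)) :=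
    tendsto_const_nhds.sub ((hF.mul tendsto_const_nhds).mul (tendsto_transpose_pow hF))
  simpa using isClosed_posSemidef.mem_of_tendsto ht (Eventually.of_forall hk)

theorem posSemidef_dlyap_sub (hF : Tendsto (fun k : ℕ => F ^ k) atTop (𝓝 0)) (hN : N.PosSemidef) :
    (dlyap F N - N).PosSemidef := by
  rw [sub_eq_iff_eq_add.2 (dlyap_eq (N := N) hF)]
  exact posSemidef_mul_mul_transpose (posSemidef_dlyap hF hN) F

theorem posDef_dlyap (hF : Tendsto (fun k : ℕ => F ^ k) atTop (𝓝 0)) (hN : N.PosDef) :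
    (dlyap F N).PosDef := by
  simpa using hN.add_posSemidef (posSemidef_dlyap_sub hF hN.posSemidef)

/-- Duality of the two Lyapunov equations. -/
theorem trace_mul_dlyap (hF : Tendsto (fun k : ℕ => F ^ k) atTop (𝓝 0))
    (C N : Matrix (Fin n) (Fin n) ℝ) :
    (C * dlyap F N).trace = (dlyap Fᵀ C * N).trace := by
  have h1 := dlyap_eq (N := N) hF
  have h2 := dlyap_eq (N := C) (tendsto_transpose_pow hF)
  rw [Matrix.transpose_transpose] at h2
  set S := dlyap F N
  set P := dlyap Fᵀ C
  -- Eliminating C and N, both traces become tr(PS) - tr(Fᵀ P F S).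
  have hC : C = P - Fᵀ * P * F := by rw [eq_sub_iff_add_eq, add_comm]; exact h2.symm
  have hN : N = S - F * S * Fᵀ := by rw [eq_sub_iff_add_eq, add_comm]; exact h1.symm
  rw [hC, hN, Matrix.sub_mul, Matrix.mul_sub, Matrix.trace_sub, Matrix.trace_sub,
    Matrix.mul_assoc, Matrix.mul_assoc, Matrix.trace_mul_comm Fᵀ]
  simp only [Matrix.mul_assoc]

end Lyapunov

/-! ### Smooth dependence of Lyapunov solutions on the coefficient -/

section Smooth

/-- The topology on matrices, obtained from the Frobenius norm. -/
local instance frobeniusTopology {ι κ : Type*} [Fintype ι] [Fintype κ] :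
    TopologicalSpace (Matrix ι κ ℝ) :=
  (inferInstance : NormedAddCommGroup (Matrix ι κ ℝ)).toMetricSpace.toPseudoMetricSpace
    |>.toUniformSpace.toTopologicalSpace

/-- Multiplication of matrices as a continuous bilinear map. -/
def mulBilin (ι κ μ : Type*) [Fintype ι] [Fintype κ] [Fintype μ] :
    Matrix ι κ ℝ →L[ℝ] Matrix κ μ ℝ →L[ℝ] Matrix ι μ ℝ :=
  LinearMap.mkContinuous₂
    (LinearMap.mk₂ ℝ (fun (X : Matrix ι κ ℝ) (Y : Matrix κ μ ℝ) => X * Y)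
      (fun _ _ _ => Matrix.add_mul _ _ _) (fun _ _ _ => Matrix.smul_mul _ _ _)
      (fun _ _ _ => Matrix.mul_add _ _ _) (fun _ _ _ => Matrix.mul_smul _ _ _)) 1
    fun X Y => by simpa using Matrix.frobenius_norm_mul X Y

/-- Transposition as a continuous linear map. -/
def transposeL (ι κ : Type*) [Fintype ι] [Fintype κ] : Matrix ι κ ℝ →L[ℝ] Matrix κ ι ℝ :=
  LinearMap.toContinuousLinearMap (Matrix.transposeLinearEquiv ι κ ℝ ℝ).toLinearMap

/-- The trace as a continuous linear map. -/
def traceL (ι : Type*) [Fintype ι] : Matrix ι ι ℝ →L[ℝ] ℝ :=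
  LinearMap.toContinuousLinearMap (Matrix.traceLinearMap ι ℝ ℝ)

variable {E ι κ μ : Type*} [NormedAddCommGroup E] [NormedSpace ℝ E]
  [Fintype ι] [Fintype κ] [Fintype μ] {x : E}

theorem _root_.ContDiffAt.matrix_mul {f : E → Matrix ι κ ℝ} {g : E → Matrix κ μ ℝ}
    (hf : ContDiffAt ℝ ∞ f x) (hg : ContDiffAt ℝ ∞ g x) :
    ContDiffAt ℝ ∞ (fun y => f y * g y) x :=
  (mulBilin ι κ μ).isBoundedBilinearMap.contDiff.contDiffAt.comp (f := fun y => (f y, g y)) x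
    (hf.prodMk hg)

theorem _root_.ContDiffAt.matrix_transpose {f : E → Matrix ι κ ℝ} (hf : ContDiffAt ℝ ∞ f x) :
    ContDiffAt ℝ ∞ (fun y => (f y)ᵀ) x :=
  (transposeL ι κ).contDiff.contDiffAt.comp x hf

theorem _root_.ContDiffAt.matrix_trace {f : E → Matrix ι ι ℝ} (hf : ContDiffAt ℝ ∞ f x) :
    ContDiffAt ℝ ∞ (fun y => (f y).trace) x :=
  (traceL ι).contDiff.contDiffAt.comp x hf

variable {n : ℕ} {F : Matrix (Fin n) (Fin n) ℝ}

/-- The continuous linear map `X ↦ X - F X Fᵀ`. -/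
def lyapMapL (F : Matrix (Fin n) (Fin n) ℝ) :
    Matrix (Fin n) (Fin n) ℝ →L[ℝ] Matrix (Fin n) (Fin n) ℝ :=
  ContinuousLinearMap.id ℝ _ -
    ((mulBilin (Fin n) (Fin n) (Fin n)).flip Fᵀ).comp (mulBilin (Fin n) (Fin n) (Fin n) F)

/-- `dlyap` depends smoothly on its coefficient. -/
theorem contDiffAt_dlyap (hF : IsSchur F) (N : Matrix (Fin n) (Fin n) ℝ) :
    ContDiffAt ℝ ∞ (fun G => dlyap G N) F := by
  have hinj := lyapMap_injective (tendsto_pow_of_isSchur hF)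
  let e : Matrix (Fin n) (Fin n) ℝ ≃L[ℝ] Matrix (Fin n) (Fin n) ℝ :=
    (LinearEquiv.ofInjectiveEndo (lyapMap F) hinj).toContinuousLinearEquiv
  have he : (e : Matrix (Fin n) (Fin n) ℝ →L[ℝ] Matrix (Fin n) (Fin n) ℝ) = lyapMapL F := rfl
  have hL : ContDiff ℝ ∞ (lyapMapL : Matrix (Fin n) (Fin n) ℝ → _) := by
    refine contDiff_const.sub (ContDiff.clm_comp ?_ ?_)
    · exact ((mulBilin (Fin n) (Fin n) (Fin n)).flip.comp
        (transposeL (Fin n) (Fin n))).contDiff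
    · exact (mulBilin (Fin n) (Fin n) (Fin n)).contDiff
  -- Inversion of operators is smooth at an invertible one, and near F `dlyap G N` is the inverse
  -- Lyapunov operator applied to N.
  have h1 : ContDiffAt ℝ ∞ (fun G => (lyapMapL G).inverse N) F := by
    have h2 := contDiffAt_map_inverse (𝕜 := ℝ) (n := ∞) e
    rw [he] at h2
    exact (h2.comp F hL.contDiffAt).clm_apply contDiffAt_const
  refine h1.congr_of_eventuallyEq ?_
  filter_upwards [isOpen_isSchur.mem_nhds hF] with G hG
  have hG' := tendsto_pow_of_isSchur hG
  let eG : Matrix (Fin n) (Fin n) ℝ ≃L[ℝ] Matrix (Fin n) (Fin n) ℝ :=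
    (LinearEquiv.ofInjectiveEndo (lyapMap G) (lyapMap_injective hG')).toContinuousLinearEquiv
  have heG : lyapMapL G = (eG : Matrix (Fin n) (Fin n) ℝ →L[ℝ] Matrix (Fin n) (Fin n) ℝ) := rfl
  rw [heG, ContinuousLinearMap.inverse_equiv]
  refine (eG.symm_apply_eq.2 ?_).symm
  exact (lyapMap_eq_iff.2 (dlyap_eq hG')).symm

end Smooth

end RiskLQR

/-! ### Coercivity, the Lagrangian and its gradient, compact sublevel sets -/

namespace RiskLQR

/-- A function with compact sublevel sets on an open set is coercive there. -/
theorem coerciveOn_of_isCompact_sublevel {E : Type*} [NormedAddCommGroup E] {f : E → ℝ}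
    {S : Set E} (hS : IsOpen S) (h : ∀ α, IsCompact {x | x ∈ S ∧ f x ≤ α}) : CoerciveOn f S := by
  refine ⟨tendsto_atTop.2 fun b => ?_, fun x hx => tendsto_atTop.2 fun b => ?_⟩
  · rw [eventually_inf_principal]
    filter_upwards [Bornology.isBounded_def.1 (h b).isBounded] with x hx hxS
    by_contra! hlt
    exact hx ⟨hxS, hlt.le⟩
  · have hxS : x ∉ S := fun hmem => by
      rw [hS.frontier_eq] at hx
      exact hx.2 hmem
    rw [eventually_nhdsWithin_iff]
    filter_upwards [(h b).isClosed.isOpen_compl.mem_nhds fun hmem => hxS hmem.1] with y hy hyS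
    by_contra! hlt
    exact hy ⟨hyS, hlt.le⟩

theorem abs_trace_mul_mul_le {ι κ μ : Type*} [Fintype ι] [Fintype κ] [Fintype μ]
    (X : Matrix ι κ ℝ) (Y : Matrix κ μ ℝ) (Z : Matrix μ ι ℝ) :
    |(X * Y * Z).trace| ≤ ‖traceL ι‖ * (‖X‖ * ‖Y‖ * ‖Z‖) := by
  have h1 : |(X * Y * Z).trace| ≤ ‖traceL ι‖ * ‖X * Y * Z‖ := (traceL ι).le_opNorm (X * Y * Z)
  refine h1.trans ?_
  gcongr
  refine (Matrix.frobenius_norm_mul _ _).trans ?_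
  gcongr
  exact Matrix.frobenius_norm_mul _ _

/-- If `Y ≥ w ≥ 0` then `w ‖M‖ ≤ ‖M Y‖`, in squared form. -/
theorem sq_mul_norm_sq_le_norm_mul_sq {ι κ : Type*} [Fintype ι] [Fintype κ] [DecidableEq κ]
    {Y : Matrix κ κ ℝ} {w : ℝ} (hw0 : 0 ≤ w) (hw : (Y - w • (1 : Matrix κ κ ℝ)).PosSemidef)
    (M : Matrix ι κ ℝ) : w ^ 2 * ‖M‖ ^ 2 ≤ ‖M * Y‖ ^ 2 := by
  set Z := Y - w • (1 : Matrix κ κ ℝ) with hZ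
  have hYZ : Y = Z + w • (1 : Matrix κ κ ℝ) := by rw [hZ]; abel
  have hZt := transpose_eq_of_posSemidef hw
  have hYt : Yᵀ = Y := by rw [hYZ]; simp [hZt]
  -- With Z = Y - w ≥ 0, one has Y² - w² = Z² + 2wZ.
  have hsq : (Y * Y - w ^ 2 • (1 : Matrix κ κ ℝ)).PosSemidef := by
    have h1 := (posSemidef_transpose_mul_self Z).add (hw.smul (mul_nonneg zero_le_two hw0))
    rw [hZt] at h1
    convert h1 using 1
    rw [hYZ]
    simp only [Matrix.mul_add, Matrix.add_mul, Matrix.smul_mul, Matrix.mul_smul, Matrix.one_mul,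
      Matrix.mul_one]
    module
  have h2 := mul_trace_le_trace_mul (posSemidef_transpose_mul_self M) hsq
  rw [trace_transpose_mul_self] at h2
  rw [← trace_transpose_mul_self (M * Y), Matrix.transpose_mul, hYt]
  refine h2.trans_eq ?_
  rw [← Matrix.mul_assoc, Matrix.trace_mul_comm]
  simp only [Matrix.mul_assoc]

namespace Data

variable {n m d : ℕ} {p : Data n m d} {lam : ℝ}
  {K K' : Matrix (Fin m) (Fin n) ℝ}

/-- Full row rank makes v ↦ vᵀH injective, so the congruence by H preserves definiteness. -/
theorem noiseCov_posDef (hlaw : IsNoiseLaw p.law) (hH : p.H.rank = n) : p.noiseCov.PosDef := by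
  have hinj : Function.Injective p.H.vecMul := by
    rw [Matrix.vecMul_injective_iff, linearIndependent_iff_card_eq_finrank_span,
      Set.finrank, ← Matrix.rank_eq_finrank_span_row, hH, Fintype.card_fin]
  simpa [noiseCov] using hlaw.cov_posDef.mul_mul_conjTranspose_same hinj

theorem isOpen_stab : IsOpen p.stab := by
  have hc : Continuous p.AK := by unfold AK; fun_prop
  exact isOpen_isSchur.preimage hc

theorem tendsto_AK_pow (hK : K ∈ p.stab) : Tendsto (fun k : ℕ => p.AK K ^ k) atTop (𝓝 0) :=
  tendsto_pow_of_isSchur hK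

/-- The state part `Q + 4 λ Qc H Σ_W Hᵀ Qc` of the cost. -/
def stateCost (p : Data n m d) (lam : ℝ) : Matrix (Fin n) (Fin n) ℝ :=
  p.Q + (4 * lam) • (p.Qc * p.noiseCov * p.Qc)

theorem costK_eq : p.costK lam K = p.stateCost lam + Kᵀ * p.R * K := by
  rw [costK, QK, stateCost]; abel

theorem stateCost_posDef (hW : p.noiseCov.PosDef) (hQ : p.Q.PosDef) (hQc : p.Qc.PosSemidef)
    (hlam : 0 ≤ lam) : (p.stateCost lam).PosDef := by
  have h := posSemidef_mul_mul_transpose hW.posSemidef p.Qc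
  rw [transpose_eq_of_posSemidef hQc] at h
  exact hQ.add_posSemidef (h.smul (by positivity))

theorem costK_posDef (hC : (p.stateCost lam).PosDef) (hR : p.R.PosDef) :
    (p.costK lam K).PosDef := by
  rw [costK_eq]
  exact hC.add_posSemidef (posSemidef_transpose_mul_mul hR.posSemidef K)

/-- The risk constraint only modifies the state cost; everything independent of K goes into
`betaConst`. -/
theorem lagr_eq : p.lagr lam K = (p.costK lam K * p.Sig K).trace + lam * p.betaConst := by
  simp only [lagr, gammaSq, betaConst, costK, pow_two, Matrix.add_mul, Matrix.mul_sub,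
    Matrix.smul_mul, Matrix.trace_add, Matrix.trace_sub, Matrix.trace_smul, smul_eq_mul,
    Matrix.mul_assoc]
  ring

theorem Sig_eq (hK : K ∈ p.stab) : p.Sig K = p.AK K * p.Sig K * (p.AK K)ᵀ + p.noiseCov :=
  dlyap_eq (tendsto_AK_pow hK)

theorem Sig_posDef (hW : p.noiseCov.PosDef) (hK : K ∈ p.stab) : (p.Sig K).PosDef :=
  posDef_dlyap (tendsto_AK_pow hK) hW

theorem P_eq (hK : K ∈ p.stab) :
    p.P lam K = (p.AK K)ᵀ * p.P lam K * p.AK K + p.costK lam K := by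
  have h := dlyap_eq (N := p.costK lam K) (tendsto_transpose_pow (tendsto_AK_pow hK))
  rwa [Matrix.transpose_transpose] at h

theorem P_posSemidef (hC : (p.stateCost lam).PosDef) (hR : p.R.PosDef) (hK : K ∈ p.stab) :
    (p.P lam K).PosSemidef :=
  posSemidef_dlyap (tendsto_transpose_pow (tendsto_AK_pow hK)) (costK_posDef hC hR).posSemidef

theorem lagr_eq_trace_P (hK : K ∈ p.stab) :
    p.lagr lam K = (p.P lam K * p.noiseCov).trace + lam * p.betaConst := by
  rw [lagr_eq, Sig, trace_mul_dlyap (tendsto_AK_pow hK), P]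

/-- The matrix `R K + Bᵀ P_(K,λ) A_K`. -/
def natGrad (p : Data n m d) (lam : ℝ) (K : Matrix (Fin m) (Fin n) ℝ) : Matrix (Fin m) (Fin n) ℝ :=
  p.R * K + p.Bᵀ * p.P lam K * p.AK K

/-- The matrix `R + Bᵀ P_(K,λ) B`. -/
def hessMat (p : Data n m d) (lam : ℝ) (K : Matrix (Fin m) (Fin n) ℝ) : Matrix (Fin m) (Fin m) ℝ :=
  p.R + p.Bᵀ * p.P lam K * p.B

/-- The exact second-order expansion of the Lagrangian. -/
theorem lagr_sub_lagr (hC : (p.stateCost lam).PosDef) (hR : p.R.PosDef)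
    (hW : p.noiseCov.PosDef) (hK : K ∈ p.stab) (hK' : K' ∈ p.stab) :
    p.lagr lam K' - p.lagr lam K =
      2 * ((p.natGrad lam K)ᵀ * (K' - K) * p.Sig K').trace +
        ((K' - K)ᵀ * p.hessMat lam K * (K' - K) * p.Sig K').trace := by
  have hRt := transpose_eq_of_posSemidef hR.posSemidef
  have hPt := transpose_eq_of_posSemidef (P_posSemidef hC hR hK)
  have hSt := transpose_eq_of_posSemidef (Sig_posDef hW hK').posSemidef
  have hN : p.noiseCov = p.Sig K' - p.AK K' * p.Sig K' * (p.AK K')ᵀ := by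
    rw [eq_sub_iff_add_eq, add_comm]; exact (Sig_eq hK').symm
  -- Expressing W through Σ_{K'} while P stays at K puts both Lagrangian values against the same
  -- Σ_{K'}; this makes the expansion exact.
  have hPW : (p.P lam K * p.noiseCov).trace =
      ((p.P lam K - (p.AK K')ᵀ * p.P lam K * p.AK K') * p.Sig K').trace := by
    rw [hN, Matrix.mul_sub, Matrix.sub_mul, Matrix.trace_sub, Matrix.trace_sub,
      ← Matrix.mul_assoc (p.P lam K) (p.AK K' * _), Matrix.trace_mul_comm _ (p.AK K')ᵀ]
    simp only [Matrix.mul_assoc]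
  obtain ⟨D, rfl⟩ : ∃ D, K' = K + D := ⟨K' - K, by abel⟩
  rw [add_sub_cancel_left]
  have hA : p.AK (K + D) = p.AK K + p.B * D := by
    simp only [AK, Matrix.mul_add]; abel
  have hCK : p.costK lam (K + D) = p.costK lam K +
      (Kᵀ * p.R * D + Dᵀ * p.R * K + Dᵀ * p.R * D) := by
    simp only [costK_eq, Matrix.transpose_add, Matrix.mul_add, Matrix.add_mul]; abel
  have hM : p.costK lam (K + D) - (p.P lam K - (p.AK (K + D))ᵀ * p.P lam K * p.AK (K + D)) =
      (p.natGrad lam K)ᵀ * D + Dᵀ * p.natGrad lam K + Dᵀ * p.hessMat lam K * D := by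
    have hP : p.costK lam K = p.P lam K - (p.AK K)ᵀ * p.P lam K * p.AK K := by
      rw [eq_sub_iff_add_eq, add_comm]; exact (P_eq hK).symm
    rw [hCK, hP, hA, natGrad, hessMat]
    simp only [Matrix.transpose_add, Matrix.transpose_mul, Matrix.transpose_transpose, hRt, hPt,
      Matrix.mul_add, Matrix.add_mul, Matrix.mul_assoc]
    abel
  have hsymm : (Dᵀ * p.natGrad lam K * p.Sig (K + D)).trace =
      ((p.natGrad lam K)ᵀ * D * p.Sig (K + D)).trace := by
    rw [← Matrix.trace_transpose, Matrix.transpose_mul, hSt, Matrix.transpose_mul,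
      Matrix.transpose_transpose, Matrix.trace_mul_comm]
  rw [lagr_eq, lagr_eq_trace_P hK, hPW, add_sub_add_right_eq_sub, ← Matrix.trace_sub,
    ← Matrix.sub_mul, hM, Matrix.add_mul, Matrix.add_mul, Matrix.trace_add, Matrix.trace_add, hsymm]
  ring

theorem contDiffAt_Sig (hK : K ∈ p.stab) : ContDiffAt ℝ ∞ p.Sig K :=
  (contDiffAt_dlyap hK p.noiseCov).comp (f := p.AK) K
    (contDiffAt_const.add (contDiffAt_const.matrix_mul contDiffAt_id))

theorem contDiffAt_gammaSq (hK : K ∈ p.stab) : ContDiffAt ℝ ∞ p.gammaSq K :=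
  (contDiffAt_const.mul (contDiffAt_const.matrix_mul
    ((contDiffAt_Sig hK).sub contDiffAt_const)).matrix_trace).add contDiffAt_const

theorem contDiffAt_lagr (hK : K ∈ p.stab) : ContDiffAt ℝ ∞ (p.lagr lam) K :=
  ((contDiffAt_const.add ((contDiffAt_id.matrix_transpose.matrix_mul
    contDiffAt_const).matrix_mul contDiffAt_id)).matrix_mul (contDiffAt_Sig hK)).matrix_trace.add
    (contDiffAt_const.mul ((contDiffAt_gammaSq hK).sub contDiffAt_const))

/-- By the exact expansion, the difference quotient along K + tE equals 2 tr(Mᵀ E Σ_{K+tE}) + t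
tr(…), which is continuous at t = 0. No derivative of Σ_K or P_K has to be computed. -/
theorem fderiv_lagr (hC : (p.stateCost lam).PosDef) (hR : p.R.PosDef)
    (hW : p.noiseCov.PosDef) (hK : K ∈ p.stab) (E : Matrix (Fin m) (Fin n) ℝ) :
    fderiv ℝ (p.lagr lam) K E = 2 * ((p.natGrad lam K)ᵀ * E * p.Sig K).trace := by
  have hd : DifferentiableAt ℝ (p.lagr lam) K := (contDiffAt_lagr hK).differentiableAt (by simp)
  have h1 : HasDerivAt (fun t : ℝ => p.lagr lam (K + t • E)) (fderiv ℝ (p.lagr lam) K E) 0 :=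
    hd.hasFDerivAt.hasLineDerivAt E
  rw [hasDerivAt_iff_tendsto_slope] at h1
  have hline : ContDiffAt ℝ ∞ (fun t : ℝ => K + t • E) 0 := by fun_prop
  have hSig : ContDiffAt ℝ ∞ (fun t : ℝ => p.Sig (K + t • E)) 0 := by
    have h : ContDiffAt ℝ ∞ p.Sig (K + (0 : ℝ) • E) := by simpa using contDiffAt_Sig hK
    exact h.comp (0 : ℝ) hline
  have hh : ContDiffAt ℝ ∞ (fun t : ℝ => 2 * ((p.natGrad lam K)ᵀ * E * p.Sig (K + t • E)).trace +
      t * (Eᵀ * p.hessMat lam K * E * p.Sig (K + t • E)).trace) 0 :=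
    (contDiffAt_const.mul (contDiffAt_const.matrix_mul hSig).matrix_trace).add
      (contDiffAt_id.mul (contDiffAt_const.matrix_mul hSig).matrix_trace)
  have h2 := hh.continuousAt.tendsto.mono_left (nhdsWithin_le_nhds (s := {0}ᶜ))
  simp only [zero_smul, add_zero, zero_mul] at h2
  have hev : ∀ᶠ t : ℝ in 𝓝 0, K + t • E ∈ p.stab := by
    refine hline.continuousAt.eventually_mem (isOpen_stab.mem_nhds ?_)
    simpa using hK
  refine tendsto_nhds_unique h1 (h2.congr' ?_)
  filter_upwards [nhdsWithin_le_nhds hev, self_mem_nhdsWithin] with t ht ht0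
  have ht0 : t ≠ 0 := ht0
  rw [slope_def_field]
  simp only [zero_smul, add_zero, sub_zero]
  rw [lagr_sub_lagr hC hR hW hK ht, add_sub_cancel_left]
  simp only [Matrix.transpose_smul, Matrix.smul_mul, Matrix.mul_smul, Matrix.trace_smul,
    smul_eq_mul]
  field_simp

theorem frobGrad_lagr (hC : (p.stateCost lam).PosDef) (hR : p.R.PosDef)
    (hW : p.noiseCov.PosDef) (hK : K ∈ p.stab) :
    frobGrad (p.lagr lam) K = (2 : ℝ) • (p.natGrad lam K * p.Sig K) := by
  have hSt := transpose_eq_of_posSemidef (Sig_posDef hW hK).posSemidef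
  have key : ∀ E : Matrix (Fin m) (Fin n) ℝ, ((frobGrad (p.lagr lam) K - (2 : ℝ) • (p.natGrad lam K * p.Sig K))ᵀ * E).trace
      = 0 := by
    intro E
    rw [Matrix.transpose_sub, Matrix.sub_mul, Matrix.trace_sub, trace_frobGrad_mul,
      fderiv_lagr hC hR hW hK, Matrix.transpose_smul, Matrix.transpose_mul, hSt, Matrix.smul_mul,
      Matrix.trace_smul, smul_eq_mul, Matrix.mul_assoc (p.Sig K), Matrix.trace_mul_comm (p.Sig K),
      sub_self]
  have h := key (frobGrad (p.lagr lam) K - (2 : ℝ) • (p.natGrad lam K * p.Sig K))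
  rw [trace_transpose_mul_self] at h
  exact sub_eq_zero.1 (norm_eq_zero.1 (pow_eq_zero_iff two_ne_zero |>.1 h))

theorem posSemidef_Sig_sub_smul_one {w : ℝ} (hW : p.noiseCov.PosDef)
    (hw : (p.noiseCov - w • (1 : Matrix (Fin n) (Fin n) ℝ)).PosSemidef) (hK : K ∈ p.stab) :
    (p.Sig K - w • (1 : Matrix (Fin n) (Fin n) ℝ)).PosSemidef := by
  simpa [Sig] using (posSemidef_dlyap_sub (tendsto_AK_pow hK) hW.posSemidef).add hw

/-- Stability is an open condition on K, so closedness is sought for pairs (K, X): X ≥ 0, the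
Lyapunov equation and the cost bound are closed conditions, and together the first two force K to be
stabilizing and X = Σ_K. -/
theorem isCompact_sublevel (hC : (p.stateCost lam).PosDef) (hR : p.R.PosDef)
    (hW : p.noiseCov.PosDef) (α : ℝ) : IsCompact (p.sublevel lam α) := by
  set T : Set (Matrix (Fin m) (Fin n) ℝ × Matrix (Fin n) (Fin n) ℝ) :=
    {q | q.2.PosSemidef ∧ q.2 = p.AK q.1 * q.2 * (p.AK q.1)ᵀ + p.noiseCov ∧
      (p.costK lam q.1 * q.2).trace + lam * p.betaConst ≤ α} with hT
  have himage : p.sublevel lam α = Prod.fst '' T := by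
    ext K
    constructor
    · rintro ⟨hK, hle⟩
      exact ⟨(K, p.Sig K), ⟨(Sig_posDef hW hK).posSemidef, Sig_eq hK, lagr_eq ▸ hle⟩, rfl⟩
    · rintro ⟨⟨K, X⟩, ⟨hX, heq, hle⟩, rfl⟩
      dsimp only at hX heq hle ⊢
      have hK : K ∈ p.stab := by
        refine isSchur_of_posDef_sub hX ?_
        rwa [sub_eq_iff_eq_add.2 (heq.trans (add_comm _ _))]
      have hXS : X = p.Sig K := (eq_lyap_iff_eq_dlyap (tendsto_AK_pow hK)).1 heq
      exact ⟨hK, by rw [lagr_eq, ← hXS]; exact hle⟩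
  have hclosed : IsClosed T := by
    have h1 : IsClosed {q : Matrix (Fin m) (Fin n) ℝ × Matrix (Fin n) (Fin n) ℝ |
        q.2.PosSemidef} := isClosed_posSemidef.preimage continuous_snd
    have h2 : IsClosed {q : Matrix (Fin m) (Fin n) ℝ × Matrix (Fin n) (Fin n) ℝ |
        q.2 = p.AK q.1 * q.2 * (p.AK q.1)ᵀ + p.noiseCov} := by
      refine isClosed_eq continuous_snd ?_
      unfold AK; fun_prop
    have h3 : IsClosed {q : Matrix (Fin m) (Fin n) ℝ × Matrix (Fin n) (Fin n) ℝ |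
        (p.costK lam q.1 * q.2).trace + lam * p.betaConst ≤ α} := by
      refine isClosed_le ?_ continuous_const
      unfold costK QK; fun_prop
    exact h1.inter (h2.inter h3)
  have hbdd : Bornology.IsBounded T := by
    obtain ⟨ε, hε, hCε⟩ := exists_posSemidef_sub_smul_one hC
    obtain ⟨r, hr, hRr⟩ := exists_posSemidef_sub_smul_one hR
    obtain ⟨w, hw, hWw⟩ := exists_posSemidef_sub_smul_one hW
    rw [isBounded_iff_forall_norm_le]
    -- The cost bound controls ε‖X‖ and r w ‖K‖² separately; ‖K‖ ≤ 1 + ‖K‖² avoids a square root.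
    refine ⟨max (1 + (α - lam * p.betaConst) / (r * w)) ((α - lam * p.betaConst) / ε), ?_⟩
    rintro ⟨K, X⟩ ⟨hX, heq, hle⟩
    dsimp only at hX heq hle
    have hXw : (X - w • (1 : Matrix (Fin n) (Fin n) ℝ)).PosSemidef := by
      have := (posSemidef_mul_mul_transpose hX (p.AK K)).add hWw
      rwa [← add_sub_assoc, ← heq] at this
    have h1 : ε * ‖X‖ ≤ (p.stateCost lam * X).trace := by
      rw [Matrix.trace_mul_comm]
      refine le_trans ?_ (mul_trace_le_trace_mul hX hCε)
      gcongr
      exact norm_le_trace hX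
    have h2 := mul_norm_sq_le_trace hRr hR.posSemidef hw.le hXw K
    rw [costK_eq, Matrix.add_mul, Matrix.trace_add] at hle
    have h3 : 0 ≤ ε * ‖X‖ := by positivity
    have h4 : 0 ≤ r * w * ‖K‖ ^ 2 := by positivity
    rw [Prod.norm_def]
    refine max_le_max ?_ ?_
    · have : ‖K‖ ^ 2 ≤ (α - lam * p.betaConst) / (r * w) := by
        rw [le_div_iff₀ (by positivity)]; linarith
      nlinarith [sq_nonneg (‖K‖ - 1)]
    · rw [le_div_iff₀ hε]; linarith
  rw [himage]
  have : ProperSpace (Matrix (Fin m) (Fin n) ℝ) := FiniteDimensional.proper ℝ _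
  have : ProperSpace (Matrix (Fin n) (Fin n) ℝ) := FiniteDimensional.proper ℝ _
  have hcomp : IsCompact T := Metric.isCompact_of_isClosed_isBounded hclosed hbdd
  exact hcomp.image continuous_fst

end Data

end RiskLQR

/-! ### Minimizer, quadratic growth, gradient dominance, Lipschitz gradient -/

namespace RiskLQR

namespace Data

variable {n m d : ℕ} {p : Data n m d} {lam : ℝ}
  {K K' Kstar : Matrix (Fin m) (Fin n) ℝ}

theorem hessMat_sub_posSemidef {r : ℝ} (hC : (p.stateCost lam).PosDef) (hR : p.R.PosDef)
    (hr : (p.R - r • (1 : Matrix (Fin m) (Fin m) ℝ)).PosSemidef) (hK : K ∈ p.stab) :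
    (p.hessMat lam K - r • (1 : Matrix (Fin m) (Fin m) ℝ)).PosSemidef := by
  have h := hr.add (posSemidef_transpose_mul_mul (P_posSemidef hC hR hK) p.B)
  rwa [sub_add_eq_add_sub] at h

theorem hessMat_posDef (hC : (p.stateCost lam).PosDef) (hR : p.R.PosDef) (hK : K ∈ p.stab) :
    (p.hessMat lam K).PosDef :=
  hR.add_posSemidef (posSemidef_transpose_mul_mul (P_posSemidef hC hR hK) p.B)

/-- A minimizer over the compact sublevel set through any stabilizing policy is global. -/
theorem exists_isMinOn_lagr (hC : (p.stateCost lam).PosDef) (hR : p.R.PosDef)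
    (hW : p.noiseCov.PosDef) (hAB : IsStabilizable p.A p.B) :
    ∃ K ∈ p.stab, IsMinOn (p.lagr lam) p.stab K := by
  obtain ⟨K₀, hK₀⟩ := hAB
  have hne : (p.sublevel lam (p.lagr lam K₀)).Nonempty := ⟨K₀, hK₀, le_rfl⟩
  have hcont : ContinuousOn (p.lagr lam) (p.sublevel lam (p.lagr lam K₀)) := fun K hK =>
    (contDiffAt_lagr hK.1).continuousAt.continuousWithinAt
  obtain ⟨K, hK, hmin⟩ := (isCompact_sublevel hC hR hW _).exists_isMinOn hne hcont
  refine ⟨K, hK.1, fun K' hK' => ?_⟩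
  rcases le_total (p.lagr lam K') (p.lagr lam K₀) with h | h
  · exact hmin ⟨hK', h⟩
  · exact hK.2.trans h

/-- The minimum is interior, so M Σ_K = 0, and Σ_K is invertible. -/
theorem natGrad_eq_zero_of_isMinOn (hC : (p.stateCost lam).PosDef) (hR : p.R.PosDef)
    (hW : p.noiseCov.PosDef) (hK : K ∈ p.stab) (hmin : IsMinOn (p.lagr lam) p.stab K) :
    p.natGrad lam K = 0 := by
  have hf : fderiv ℝ (p.lagr lam) K = 0 :=
    (hmin.isLocalMin (isOpen_stab.mem_nhds hK)).fderiv_eq_zero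
  have hg : frobGrad (p.lagr lam) K = 0 := by
    ext i j
    simp [frobGrad, hf]
  rw [frobGrad_lagr hC hR hW hK, smul_eq_zero_iff_right two_ne_zero] at hg
  have hu := (Matrix.isUnit_iff_isUnit_det _).1 (Sig_posDef hW hK).isUnit
  rw [← Matrix.mul_nonsing_inv_cancel_right (A := p.Sig K) (p.natGrad lam K) hu, hg,
    Matrix.zero_mul]

theorem eq_neg_of_natGrad_eq_zero (hu : IsUnit (p.hessMat lam K)) (h : p.natGrad lam K = 0) :
    K = -((p.hessMat lam K)⁻¹ * p.Bᵀ * p.P lam K * p.A) := by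
  have h1 : p.hessMat lam K * K = -(p.Bᵀ * p.P lam K * p.A) := by
    rw [eq_neg_iff_add_eq_zero, ← h, natGrad, hessMat, AK]
    simp only [Matrix.mul_add, Matrix.add_mul, Matrix.mul_assoc]
    abel
  have h2 := congrArg ((p.hessMat lam K)⁻¹ * ·) h1
  rw [Matrix.nonsing_inv_mul_cancel_left _ _ ((Matrix.isUnit_iff_isUnit_det _).1 hu)] at h2
  simpa only [Matrix.mul_neg, Matrix.mul_assoc] using h2

theorem quadratic_growth {r w : ℝ} (hC : (p.stateCost lam).PosDef) (hR : p.R.PosDef)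
    (hW : p.noiseCov.PosDef) (hr : (p.R - r • (1 : Matrix (Fin m) (Fin m) ℝ)).PosSemidef)
    (hw0 : 0 ≤ w) (hw : (p.noiseCov - w • (1 : Matrix (Fin n) (Fin n) ℝ)).PosSemidef)
    (hK : K ∈ p.stab) (hK' : K' ∈ p.stab) :
    2 * ((p.natGrad lam K)ᵀ * (K' - K) * p.Sig K').trace + r * w * ‖K' - K‖ ^ 2 ≤
      p.lagr lam K' - p.lagr lam K := by
  rw [lagr_sub_lagr hC hR hW hK hK']
  gcongr
  exact mul_norm_sq_le_trace (hessMat_sub_posSemidef hC hR hr hK)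
    (hessMat_posDef hC hR hK).posSemidef hw0 (posSemidef_Sig_sub_smul_one hW hw hK') _

/-- Gradient dominance of the Lagrangian with respect to a fixed comparison policy. -/
theorem exists_gradient_dominance (hC : (p.stateCost lam).PosDef) (hR : p.R.PosDef)
    (hW : p.noiseCov.PosDef) (hK' : K' ∈ p.stab) :
    ∃ c : ℝ, 0 < c ∧ ∀ K ∈ p.stab,
      c * (p.lagr lam K - p.lagr lam K') ≤ ‖frobGrad (p.lagr lam) K‖ ^ 2 := by
  obtain ⟨r, hr, hRr⟩ := exists_posSemidef_sub_smul_one hR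
  obtain ⟨w, hw, hWw⟩ := exists_posSemidef_sub_smul_one hW
  set s := ‖traceL (Fin n)‖ * ‖p.Sig K'‖ with hs
  -- Completing the square gives r w (L(K) - L(K')) ≤ s²‖M‖², and ‖∇L(K)‖² = 4‖M Σ_K‖² ≥ 4w²‖M‖².
  -- Since s depends only on K', the constant is uniform in K; the +1 covers s = 0.
  refine ⟨4 * w ^ 2 * (r * w) / (s ^ 2 + 1), by positivity, fun K hK => ?_⟩
  set M := p.natGrad lam K with hM
  have h1 := quadratic_growth hC hR hW hRr hw.le hWw hK hK'
  have h2 : |(Mᵀ * (K' - K) * p.Sig K').trace| ≤ s * (‖M‖ * ‖K' - K‖) := by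
    refine (abs_trace_mul_mul_le _ _ _).trans_eq ?_
    rw [Matrix.frobenius_norm_transpose, hs]
    ring
  have h3 : p.lagr lam K - p.lagr lam K' ≤ 2 * (s * (‖M‖ * ‖K' - K‖)) - r * w * ‖K' - K‖ ^ 2 := by
    linarith [neg_abs_le (Mᵀ * (K' - K) * p.Sig K').trace]
  have hrw : 0 < r * w := mul_pos hr hw
  have h4 : r * w * (p.lagr lam K - p.lagr lam K') ≤ (s ^ 2 + 1) * ‖M‖ ^ 2 := by
    calc r * w * (p.lagr lam K - p.lagr lam K')
        ≤ r * w * (2 * (s * (‖M‖ * ‖K' - K‖)) - r * w * ‖K' - K‖ ^ 2) := by gcongr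
      _ ≤ (s ^ 2 + 1) * ‖M‖ ^ 2 := by
        nlinarith [sq_nonneg (s * ‖M‖ - r * w * ‖K' - K‖), sq_nonneg ‖M‖]
  have h5 := sq_mul_norm_sq_le_norm_mul_sq hw.le (posSemidef_Sig_sub_smul_one hW hWw hK) M
  have h6 : ‖frobGrad (p.lagr lam) K‖ ^ 2 = 2 ^ 2 * ‖M * p.Sig K‖ ^ 2 := by
    rw [frobGrad_lagr hC hR hW hK, norm_smul, Real.norm_ofNat, mul_pow]
  rw [h6, div_mul_eq_mul_div, div_le_iff₀ (by positivity)]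
  calc 4 * w ^ 2 * (r * w) * (p.lagr lam K - p.lagr lam K')
      = 4 * w ^ 2 * (r * w * (p.lagr lam K - p.lagr lam K')) := by ring
    _ ≤ 4 * w ^ 2 * ((s ^ 2 + 1) * ‖M‖ ^ 2) := by gcongr
    _ = 2 ^ 2 * (w ^ 2 * ‖M‖ ^ 2) * (s ^ 2 + 1) := by ring
    _ ≤ 2 ^ 2 * ‖M * p.Sig K‖ ^ 2 * (s ^ 2 + 1) := by gcongr

section

attribute [local instance] frobeniusTopology

theorem contDiffAt_frobGrad_lagr (hK : K ∈ p.stab) :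
    ContDiffAt ℝ ∞ (frobGrad (p.lagr lam)) K := by
  have hf : ContDiffAt ℝ ∞ (fderiv ℝ (p.lagr lam)) K :=
    (contDiffAt_lagr hK).fderiv_right (by simp)
  have heq : frobGrad (p.lagr lam) = fun K => ∑ i, ∑ j,
      fderiv ℝ (p.lagr lam) K (Matrix.single i j 1) • Matrix.single i j (1 : ℝ) := by
    funext K
    refine (Matrix.matrix_eq_sum_single (frobGrad (p.lagr lam) K)).trans ?_
    refine Finset.sum_congr rfl fun i _ => Finset.sum_congr rfl fun j _ => ?_
    rw [Matrix.smul_single, smul_eq_mul, mul_one]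
    rfl
  rw [heq]
  exact ContDiffAt.sum fun i _ => ContDiffAt.sum fun j _ =>
    (hf.clm_apply contDiffAt_const).smul contDiffAt_const

end

/-- A C¹ map is locally Lipschitz, hence Lipschitz on a compact set; convexity of the sublevel set
is not needed. -/
theorem exists_lipschitz_frobGrad (hC : (p.stateCost lam).PosDef) (hR : p.R.PosDef)
    (hW : p.noiseCov.PosDef) (α : ℝ) :
    ∃ ℓ : ℝ, 0 < ℓ ∧ ∀ K ∈ p.sublevel lam α, ∀ K' ∈ p.sublevel lam α,
      ‖frobGrad (p.lagr lam) K - frobGrad (p.lagr lam) K'‖ ≤ ℓ * ‖K - K'‖ := by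
  have hloc : LocallyLipschitzOn (p.sublevel lam α) (frobGrad (p.lagr lam)) := by
    intro K hK
    obtain ⟨c, t, ht, hc⟩ :=
      ((contDiffAt_frobGrad_lagr (lam := lam) hK.1).of_le (m := 1) (by simp)).exists_lipschitzOnWith
    exact ⟨c, t, mem_nhdsWithin_of_mem_nhds ht, hc⟩
  obtain ⟨c, hc⟩ := hloc.exists_lipschitzOnWith_of_compact (isCompact_sublevel hC hR hW α)
  -- The local-to-global constant c may vanish, while ℓ must be positive.
  refine ⟨c + 1, by positivity, fun K hK K' hK' => (hc.norm_sub_le hK hK').trans ?_⟩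
  gcongr
  linarith

end Data

end RiskLQR

end

theorem lemma2 {n m d : ℕ} (p : RiskLQR.Data n m d)
    (hlaw : RiskLQR.IsNoiseLaw p.law)
    (hAB : RiskLQR.IsStabilizable p.A p.B)
    (hQ : p.Q.PosDef) (hR : p.R.PosDef) (hQc : p.Qc.PosSemidef)
    (hH : p.H.rank = n)
    (lam : ℝ) (hlam : 0 ≤ lam) :
    -- the stabilizing set is open, and `Σ_K` is well defined and positive definite on it
    (IsOpen p.stab ∧
      ∀ K ∈ p.stab, (p.Sig K).PosDef ∧
        ∀ X : Matrix (Fin n) (Fin n) ℝ,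
          X = p.AK K * X * (p.AK K)ᵀ + p.noiseCov ↔ X = p.Sig K) ∧
    -- (i) smoothness and the gradient formula
    (ContDiffOn ℝ ∞ (p.lagr lam) p.stab ∧ ContDiffOn ℝ ∞ p.gammaSq p.stab ∧
      ∀ K ∈ p.stab,
        (∀ X : Matrix (Fin n) (Fin n) ℝ,
          X = (p.AK K)ᵀ * X * p.AK K + p.QK K
              + (4 * lam) • (p.Qc * p.H * RiskLQR.covMat p.law * p.Hᵀ * p.Qc)
            ↔ X = p.P lam K) ∧
        RiskLQR.frobGrad (p.lagr lam) K =
          (2 : ℝ) • ((p.R * K + p.Bᵀ * p.P lam K * p.AK K) * p.Sig K)) ∧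
    -- (ii) coercivity and compact sublevel sets
    (RiskLQR.CoerciveOn (p.lagr lam) p.stab ∧ ∀ α : ℝ, IsCompact (p.sublevel lam α)) ∧
    -- (iii) the unique global minimizer
    ∃ Kstar ∈ p.stab,
      (IsMinOn (p.lagr lam) p.stab Kstar ∧
        (∀ K ∈ p.stab, IsMinOn (p.lagr lam) p.stab K → K = Kstar) ∧
        IsUnit (p.R + p.Bᵀ * p.P lam Kstar * p.B) ∧
        Kstar = -((p.R + p.Bᵀ * p.P lam Kstar * p.B)⁻¹ * p.Bᵀ * p.P lam Kstar * p.A) ∧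
        p.lagr lam Kstar = (p.P lam Kstar * p.noiseCov).trace + lam * p.betaConst) ∧
      -- (iv) Lipschitz gradient, gradient dominance, quadratic lower model on sublevel sets
      ∀ α : ℝ, (p.sublevel lam α).Nonempty →
        ∃ ℓ c₁ c₂ : ℝ, 0 < ℓ ∧ 0 < c₁ ∧ 0 < c₂ ∧
          ∀ K ∈ p.sublevel lam α, ∀ K' ∈ p.sublevel lam α,
            ‖RiskLQR.frobGrad (p.lagr lam) K - RiskLQR.frobGrad (p.lagr lam) K'‖
                ≤ ℓ * ‖K - K'‖ ∧
            c₂ * ‖K - Kstar‖ ^ 2 ≤ c₁ * (p.lagr lam K - p.lagr lam Kstar) ∧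
            c₁ * (p.lagr lam K - p.lagr lam Kstar)
                ≤ ‖RiskLQR.frobGrad (p.lagr lam) K‖ ^ 2 := by
  have hW := RiskLQR.Data.noiseCov_posDef hlaw hH
  have hC := RiskLQR.Data.stateCost_posDef hW hQ hQc hlam
  have hopen : IsOpen p.stab := RiskLQR.Data.isOpen_stab
  refine ⟨⟨hopen, fun K hK => ⟨RiskLQR.Data.Sig_posDef hW hK, fun X =>
    RiskLQR.eq_lyap_iff_eq_dlyap (RiskLQR.Data.tendsto_AK_pow hK)⟩⟩, ⟨fun K hK =>
    (RiskLQR.Data.contDiffAt_lagr hK).contDiffWithinAt, fun K hK =>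
    (RiskLQR.Data.contDiffAt_gammaSq hK).contDiffWithinAt, fun K hK =>
    ⟨fun X => ?_, RiskLQR.Data.frobGrad_lagr hC hR hW hK⟩⟩,
    ⟨RiskLQR.coerciveOn_of_isCompact_sublevel hopen
      (RiskLQR.Data.isCompact_sublevel hC hR hW), RiskLQR.Data.isCompact_sublevel hC hR hW⟩, ?_⟩
  · have h := RiskLQR.eq_lyap_iff_eq_dlyap (N := p.costK lam K) (X := X)
      (RiskLQR.tendsto_transpose_pow (RiskLQR.Data.tendsto_AK_pow hK))
    rw [Matrix.transpose_transpose] at h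
    rw [RiskLQR.Data.P, ← h, RiskLQR.Data.costK, RiskLQR.Data.noiseCov, ← add_assoc]
    simp only [Matrix.mul_assoc]
  obtain ⟨r, hr, hRr⟩ := RiskLQR.exists_posSemidef_sub_smul_one hR
  obtain ⟨w, hw, hWw⟩ := RiskLQR.exists_posSemidef_sub_smul_one hW
  obtain ⟨Kstar, hKs, hmin⟩ := RiskLQR.Data.exists_isMinOn_lagr hC hR hW hAB
  have hM := RiskLQR.Data.natGrad_eq_zero_of_isMinOn hC hR hW hKs hmin
  have hu := (RiskLQR.Data.hessMat_posDef hC hR hKs).isUnit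
  have hgrow : ∀ K ∈ p.stab, r * w * ‖K - Kstar‖ ^ 2 ≤ p.lagr lam K - p.lagr lam Kstar := by
    intro K hK
    simpa [hM] using RiskLQR.Data.quadratic_growth hC hR hW hRr hw.le hWw hKs hK
  refine ⟨Kstar, hKs, ⟨hmin, fun K hK hKmin => ?_, hu,
    RiskLQR.Data.eq_neg_of_natGrad_eq_zero hu hM, RiskLQR.Data.lagr_eq_trace_P hKs⟩, ?_⟩
  · have h1 : p.lagr lam K ≤ p.lagr lam Kstar := hKmin hKs
    have h2 : r * w * ‖K - Kstar‖ ^ 2 ≤ 0 := (hgrow K hK).trans (sub_nonpos.2 h1)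
    have h3 : ‖K - Kstar‖ ^ 2 ≤ 0 := nonpos_of_mul_nonpos_right h2 (mul_pos hr hw)
    exact sub_eq_zero.1 (norm_eq_zero.1 (pow_eq_zero_iff two_ne_zero |>.1
      (le_antisymm h3 (sq_nonneg _))))
  · intro α _
    obtain ⟨ℓ, hℓ, hlip⟩ := RiskLQR.Data.exists_lipschitz_frobGrad hC hR hW α
    obtain ⟨c, hc, hdom⟩ := RiskLQR.Data.exists_gradient_dominance hC hR hW hKs
    -- Quadratic growth multiplied by the dominance constant c gives c₂ = c r w. Both c₁ and c₂ work
    -- on the whole stabilizing set; only ℓ depends on α.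
    refine ⟨ℓ, c, c * (r * w), hℓ, hc, by positivity, fun K hK K' hK' =>
      ⟨hlip K hK K' hK', ?_, hdom K hK.1⟩⟩
    rw [mul_assoc]
    exact mul_le_mul_of_nonneg_left (hgrow K hK.1) hc.le
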